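/- Let $H$ be a left quaternionic Hilbert space: a left $\mathbb{H}$-module with an $\mathbb{H}$-valued inner product $(\cdot,\cdot)$ that is left $\mathbb{H}$-linear in the first variable, satisfies $(u,v)=\overline{(v,u)}$ and is positive definite, and that is complete for the norm $\|u\|=(u,u)^{1/2}$. Let $T:H\to H$ be a bounded left $\mathbb{H}$-linear operator with adjoint $T^*$ (so $(Tu,v)=(u,T^*v)$ for all $u,v\in H$). Assume that $T$ is normal ($TT^*=T^*T$) and compact (the image of every bounded set has compact closure). A quaternion $q$ is called an eigenvalue of $T$ if $Tu=qu$ for some $u\in H\setminus\{0\}$. Put $K=TT^*$. Then there are a finite (possibly empty) or countably infinite sequence $\lambda_1,\lambda_2,\dots$ of quaternions with $|\lambda_1|\ge|\lambda_2|\ge\cdots$ and a sequence $\xi_1,\xi_2,\dots$ of unit vectors of $H$, indexed by the same set, such that: 1. every $\lambda_k$ is an eigenvalue of $T$, and $|\lambda_k|\to 0$ if the sequence is infinite; 2. $T\xi_k=\lambda_k\xi_k$ and $K\xi_k=|\lambda_k|^2\xi_k$ for every $k$, and for every $u\in H$ $$Tu=\sum_{k}(u,\xi_k)\lambda_k\xi_k,\qquad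 Ku=\sum_{k}(u,\xi_k)|\lambda_k|^2\xi_k,$$ where the series converge unconditionally in the norm of $H$; 3. if $0$ is not an eigenvalue of $T$, then $\{\xi_k\}$ is an orthonormal basis of $H$, i.e. the $\xi_k$ are pairwise orthogonal unit vectors whose left $\mathbb{H}$-linear span is dense in $H$. -/

import Mathlib

open scoped Quaternion Topology
open Filter

/-- A left quaternionic inner product space: a left `ℍ`-module with an `ℍ`-valued inner product
which is Hermitian, left `ℍ`-linear in the first variable, and such that `(u, u) = ‖u‖ ^ 2`
(so it is positive definite and the norm is the one it induces).
With `[CompleteSpace H]` this is a left quaternionic Hilbert space. -/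
class LeftQuaternionicInnerProductSpace (H : Type*) [NormedAddCommGroup H]
    extends Module ℍ H where
  /-- The inner product `(u, v)`. -/
  qinner : H → H → ℍ
  qinner_conj_symm : ∀ u v : H, qinner u v = star (qinner v u)
  qinner_add_left : ∀ u v w : H, qinner (u + v) w = qinner u w + qinner v w
  qinner_smul_left : ∀ (q : ℍ) (u v : H), qinner (q • u) v = q * qinner u v
  qinner_self : ∀ u : H, qinner u u = ((‖u‖ ^ 2 : ℝ) : ℍ)

namespace LeftQuaternionicInnerProductSpace

section Basic

variable {H : Type*} [NormedAddCommGroup H] [LeftQuaternionicInnerProductSpace H]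

theorem qinner_add_right (u v w : H) : qinner u (v + w) = qinner u v + qinner u w := by
  rw [qinner_conj_symm, qinner_add_left, star_add, ← qinner_conj_symm, ← qinner_conj_symm]

theorem qinner_smul_right (q : ℍ) (u v : H) : qinner u (q • v) = qinner u v * star q := by
  rw [qinner_conj_symm, qinner_smul_left, star_mul, ← qinner_conj_symm]

theorem norm_quaternion_smul (q : ℍ) (u : H) : ‖q • u‖ = ‖q‖ * ‖u‖ := by
  have h : ((‖q • u‖ ^ 2 : ℝ) : ℍ) = (((‖q‖ * ‖u‖) ^ 2 : ℝ) : ℍ) := by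
    rw [← qinner_self, qinner_smul_left, qinner_smul_right, qinner_self,
      Quaternion.coe_commutes, ← mul_assoc, Quaternion.self_mul_star,
      Quaternion.normSq_eq_norm_mul_self, ← Quaternion.coe_mul]
    congr 1
    ring
  have h' : ‖q • u‖ ^ 2 = (‖q‖ * ‖u‖) ^ 2 := Quaternion.coe_injective h
  exact (sq_eq_sq₀ (norm_nonneg _) (by positivity)).1 h'

/-- The underlying real normed space (not an instance). -/
noncomputable abbrev realNormedSpace (H : Type*) [NormedAddCommGroup H] [LeftQuaternionicInnerProductSpace H] :
    NormedSpace ℝ H :=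
  { Module.compHom H (algebraMap ℝ ℍ) with
    norm_smul_le := fun r u => by
      change ‖((r : ℝ) : ℍ) • u‖ ≤ _
      rw [norm_quaternion_smul, Quaternion.norm_coe] }

/-- The underlying real inner product space, with inner product `Re (u, v)` (not an instance). -/
noncomputable abbrev realInnerProductSpace (H : Type*) [NormedAddCommGroup H]
    [LeftQuaternionicInnerProductSpace H] : InnerProductSpace ℝ H :=
  { realNormedSpace H with
    inner := fun u v => (qinner u v).re
    norm_sq_eq_re_inner := fun u => by
      change ‖u‖ ^ 2 = (qinner u u).re
      rw [qinner_self, Quaternion.re_coe]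
    conj_inner_symm := fun u v => by rw [qinner_conj_symm]; simp
    add_left := fun u v w => by rw [qinner_add_left]; simp
    smul_left := fun u v r => by
      change (qinner (((r : ℝ) : ℍ) • u) v).re = _
      rw [qinner_smul_left]
      simp }

theorem quaternion_ext_re_mul {a b : ℍ} (h : ∀ q : ℍ, (q * a).re = (q * b).re) : a = b := by
  have h1 := h (star (a - b))
  rw [← sub_eq_zero, ← Quaternion.re_sub, ← mul_sub, Quaternion.star_mul_self,
    Quaternion.re_coe] at h1
  exact sub_eq_zero.1 (Quaternion.normSq_eq_zero.1 h1)

theorem ext_re_qinner {v w : H} (h : ∀ u : H, (qinner u v).re = (qinner u w).re) : v = w := by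
  let _ := realInnerProductSpace H
  exact ext_inner_left ℝ h

end Basic

section Adjoint

variable {H : Type*} [NormedAddCommGroup H] [LeftQuaternionicInnerProductSpace H]
  [CompleteSpace H]

theorem exists_qadjoint (T : H →L[ℍ] H) :
    ∃ S : H →L[ℍ] H, ∀ u v : H, qinner (T u) v = qinner u (S v) := by
  let _ := realInnerProductSpace H
  let A : H →L[ℝ] H :=
    { toFun := T
      map_add' := T.map_add
      map_smul' := fun r u => T.map_smul ((r : ℝ) : ℍ) u
      cont := T.continuous }
  have hA : ∀ u v : H, (qinner (T u) v).re = (qinner u (A.adjoint v)).re := fun u v =>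
    (ContinuousLinearMap.adjoint_inner_right A u v).symm
  have hS : ∀ u v : H, qinner (T u) v = qinner u (A.adjoint v) := fun u v =>
    quaternion_ext_re_mul fun q => by
      rw [← qinner_smul_left, ← qinner_smul_left, ← T.map_smul, hA]
  refine ⟨{ toFun := fun v => A.adjoint v
            map_add' := fun v w => map_add _ v w
            map_smul' := fun q v => ext_re_qinner fun u => ?_
            cont := A.adjoint.continuous }, hS⟩
  rw [← hS, RingHom.id_apply, qinner_smul_right, qinner_smul_right, hS]

/-- The adjoint `T*` of a bounded left `ℍ`-linear operator `T`: the unique bounded left `ℍ`-linear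
operator with `(T u, v) = (u, T* v)`. -/
noncomputable def qadjoint (T : H →L[ℍ] H) : H →L[ℍ] H :=
  Classical.choose (exists_qadjoint T)

theorem qinner_qadjoint (T : H →L[ℍ] H) (u v : H) :
    qinner (T u) v = qinner u (qadjoint T v) :=
  Classical.choose_spec (exists_qadjoint T) u v

theorem eq_qadjoint {T S : H →L[ℍ] H} (h : ∀ u v : H, qinner (T u) v = qinner u (S v)) :
    S = qadjoint T :=
  ContinuousLinearMap.ext fun v => ext_re_qinner fun u => by rw [← h, qinner_qadjoint]

/-- `T` is normal: `T T* = T* T`. -/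
def IsNormalOperator (T : H →L[ℍ] H) : Prop :=
  T ∘L qadjoint T = qadjoint T ∘L T

end Adjoint

section Notions

variable {H : Type*} [NormedAddCommGroup H] [LeftQuaternionicInnerProductSpace H]

/-- `T` is compact: the image of every bounded set has compact closure. -/
def IsCompactOp (T : H →L[ℍ] H) : Prop :=
  ∀ B : Set H, Bornology.IsBounded B → IsCompact (closure (T '' B))

/-- `q` is an eigenvalue of `T`: `T u = q u` for some `u ≠ 0`. -/
def IsEigenvalue (T : H →L[ℍ] H) (q : ℍ) : Prop :=
  ∃ u : H, u ≠ 0 ∧ T u = q • u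

/-- The family `ξ` is an orthonormal basis: its members are pairwise orthogonal unit vectors,
and their left `ℍ`-linear span is dense. -/
def IsOrthonormalBasis {ι : Type*} (ξ : ι → H) : Prop :=
  (∀ i, ‖ξ i‖ = 1) ∧ (∀ i j, i ≠ j → qinner (ξ i) (ξ j) = 0) ∧
    closure (Submodule.span ℍ (Set.range ξ) : Set H) = Set.univ

end Notions

end LeftQuaternionicInnerProductSpace

/-! Restricting scalars to `ℂ ⊂ ℍ` makes `T` a compact normal operator on a complex Hilbert space,
and its complex eigenvectors are quaternionic ones. So `T` has an eigenvector with nonzero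
eigenvalue in every closed submodule invariant under `T` and `T*` on which it is not zero
(`exists_eigenvector_mem`). Zorn's lemma gives a maximal orthonormal set `E` of eigenvectors with
nonzero eigenvalues. Normality makes them eigenvectors of `T*`, so the complement of `E` is
invariant under both operators, and maximality forces `T = 0` there. Hence `T u = T v`, where `v` is
the sum of the expansion of `u` along `E`, and applying `T` termwise gives the series. Since `‖T* w‖
= ‖T w‖`, the same works for `T T*`. If `T` is injective, then `u = v`. Compactness leaves finitely
many eigenvalues outside each ball about `0`, so `E` can be listed by decreasing modulus. -/

/-- The spectral radius of a normal operator is its norm, so the spectrum contains a nonzero point;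
by compactness that point is an eigenvalue. -/
theorem ContinuousLinearMap.exists_hasEigenvalue_ne_zero_of_isCompactOperator
    {E : Type*} [NormedAddCommGroup E] [InnerProductSpace ℂ E] [CompleteSpace E]
    {A : E →L[ℂ] E} (hA : IsCompactOperator A) [IsStarNormal A] (h0 : A ≠ 0) :
    ∃ c : ℂ, c ≠ 0 ∧ Module.End.HasEigenvalue (A : Module.End ℂ E) c := by
  by_contra! h
  apply h0
  rw [← nnnorm_eq_zero, ← ENNReal.coe_eq_zero, ← IsStarNormal.spectralRadius_eq_nnnorm A,
    spectralRadius]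
  refine ENNReal.iSup_eq_zero.2 fun c => ENNReal.iSup_eq_zero.2 fun hc => ?_
  by_cases hc0 : c = 0
  · simp [hc0]
  · exact absurd ((hA.hasEigenvalue_iff_mem_spectrum hc0).2 hc) (h c hc0)

/-- Invariance under the adjoint makes the adjoint of the restriction to `W` the restriction of the
adjoint, so the restriction is again normal. -/
theorem ContinuousLinearMap.exists_eigenvector_mem_of_isCompactOperator
    {E : Type*} [NormedAddCommGroup E] [InnerProductSpace ℂ E] [CompleteSpace E]
    {A : E →L[ℂ] E} (hA : IsCompactOperator A) [hn : IsStarNormal A] (W : Submodule ℂ E)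
    (hW : IsClosed (W : Set E)) (h1 : ∀ w ∈ W, A w ∈ W) (h2 : ∀ w ∈ W, A.adjoint w ∈ W)
    {w : E} (hw : w ∈ W) (hAw : A w ≠ 0) :
    ∃ c : ℂ, c ≠ 0 ∧ ∃ u ∈ W, u ≠ 0 ∧ A u = c • u := by
  have : CompleteSpace W := hW.completeSpace_coe
  let B : W →L[ℂ] W := A.restrict h1
  let C : W →L[ℂ] W := A.adjoint.restrict h2
  have hBC : C = B.adjoint := by
    rw [ContinuousLinearMap.eq_adjoint_iff]
    intro x y
    exact A.adjoint_inner_left (y : E) (x : E)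
  have : IsStarNormal B := by
    refine ⟨?_⟩
    rw [ContinuousLinearMap.star_eq_adjoint, ← hBC]
    ext x
    have := congrArg (fun F : E →L[ℂ] E => F x) hn.star_comm_self.eq
    exact this
  have hB : IsCompactOperator B := hA.restrict' h1
  obtain ⟨c, hc, hcB⟩ := exists_hasEigenvalue_ne_zero_of_isCompactOperator hB (fun h => hAw (by
    have := congrArg (fun F : W →L[ℂ] W => (F ⟨w, hw⟩ : E)) h
    exact this))
  obtain ⟨u, hu⟩ := hcB.exists_hasEigenvector
  exact ⟨c, hc, u, u.2, by simpa using hu.2, congrArg Subtype.val hu.apply_eq_smul⟩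

/-! ### Restriction of scalars to the complex numbers -/

namespace LeftQuaternionicInnerProductSpace

variable {H : Type*} [NormedAddCommGroup H] [LeftQuaternionicInnerProductSpace H]

theorem norm_coeComplex (z : ℂ) : ‖(z : ℍ)‖ = ‖z‖ := by
  rw [← sq_eq_sq₀ (norm_nonneg _) (norm_nonneg _), sq, ← Quaternion.normSq_eq_norm_mul_self,
    Quaternion.normSq_def', Complex.sq_norm, Complex.normSq_apply]
  simp [sq]

/-- The underlying complex normed space (not an instance). -/
noncomputable abbrev complexNormedSpace (H : Type*) [NormedAddCommGroup H]
    [LeftQuaternionicInnerProductSpace H] : NormedSpace ℂ H :=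
  { Module.compHom H (Quaternion.ofComplex : ℂ →+* ℍ) with
    norm_smul_le := fun r u => by
      change ‖(r : ℍ) • u‖ ≤ _
      rw [norm_quaternion_smul, norm_coeComplex] }

/-- The underlying complex inner product space (not an instance). -/
noncomputable abbrev complexInnerProductSpace (H : Type*) [NormedAddCommGroup H]
    [LeftQuaternionicInnerProductSpace H] : InnerProductSpace ℂ H :=
  { complexNormedSpace H with
    -- The arguments are swapped because the complex inner product is conjugate-linear in the first
    -- variable; the value is the `ℂ`-component of the quaternion.
    inner := fun u v => ⟨(qinner v u).re, (qinner v u).imI⟩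
    norm_sq_eq_re_inner := fun u => by
      change ‖u‖ ^ 2 = (qinner u u).re
      rw [qinner_self, Quaternion.re_coe]
    conj_inner_symm := fun u v => by
      rw [qinner_conj_symm]; apply Complex.ext <;> simp
    add_left := fun u v w => by
      rw [qinner_add_right]; apply Complex.ext <;> simp
    smul_left := fun u v r => by
      change (⟨(qinner v ((r : ℍ) • u)).re, (qinner v ((r : ℍ) • u)).imI⟩ : ℂ) = _
      rw [qinner_smul_right]
      apply Complex.ext <;> simp <;> ring }

theorem exists_eigenvector_mem [CompleteSpace H] {T : H →L[ℍ] H} (hc : IsCompactOp T)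
    (hn : IsNormalOperator T) (W : Submodule ℍ H) (hW : IsClosed (W : Set H))
    (h1 : ∀ w ∈ W, T w ∈ W) (h2 : ∀ w ∈ W, qadjoint T w ∈ W) {w : H} (hw : w ∈ W)
    (hTw : T w ≠ 0) : ∃ q : ℍ, q ≠ 0 ∧ ∃ u ∈ W, u ≠ 0 ∧ T u = q • u := by
  let _ := complexInnerProductSpace H
  let toC : (H →L[ℍ] H) → (H →L[ℂ] H) := fun S =>
    { toFun := S
      map_add' := S.map_add
      map_smul' := fun r u => S.map_smul (r : ℍ) u
      cont := S.continuous }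
  let WC : Submodule ℂ H :=
    { carrier := W
      add_mem' := W.add_mem
      zero_mem' := W.zero_mem
      smul_mem' := fun r _ hu => W.smul_mem (r : ℍ) hu }
  have hadj : toC (qadjoint T) = (toC T).adjoint := by
    rw [ContinuousLinearMap.eq_adjoint_iff]
    intro x y
    change (⟨(qinner y (qadjoint T x)).re, (qinner y (qadjoint T x)).imI⟩ : ℂ) =
      ⟨(qinner (T y) x).re, (qinner (T y) x).imI⟩
    rw [qinner_qadjoint]
  have : IsStarNormal (toC T) := by
    refine ⟨?_⟩
    rw [ContinuousLinearMap.star_eq_adjoint, ← hadj]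
    ext x
    exact (congrArg (fun F : H →L[ℍ] H => F x) hn).symm
  have hcomp : IsCompactOperator (toC T) :=
    ⟨closure (T '' Metric.ball 0 1), hc _ Metric.isBounded_ball,
      mem_of_superset (Metric.ball_mem_nhds 0 one_pos) fun x hx =>
        subset_closure (Set.mem_image_of_mem _ hx)⟩
  obtain ⟨c, hc0, u, hu, hu0, h⟩ :=
    ContinuousLinearMap.exists_eigenvector_mem_of_isCompactOperator hcomp WC hW h1
      (hadj ▸ h2) hw hTw
  refine ⟨c, fun h => hc0 ?_, u, hu, hu0, h⟩
  exact Quaternion.ofComplex.toRingHom.injective (by simpa using h)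

end LeftQuaternionicInnerProductSpace

/-! ### Enumeration in decreasing order -/

/-- Order `α` by decreasing `f`, breaking ties by a well-order. Every element has finitely many
predecessors, and their number is an injective rank whose values form an initial segment of `ℕ`. -/
theorem exists_enumeration_antitone {α : Type*} (f : α → ℝ) (hf : ∀ a, 0 < f a)
    (hfin : ∀ ε > 0, {a | ε ≤ f a}.Finite) :
    ∃ (N : ℕ∞) (e : {k : ℕ // (k : ℕ∞) < N} ≃ α), Antitone (f ∘ e) := by
  classical
  let r : α → α → Prop := WellOrderingRel
  let lt : α → α → Prop := fun a b => f b < f a ∨ (f a = f b ∧ r a b)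
  have lt_trans : ∀ {a b c}, lt a b → lt b c → lt a c := by
    rintro a b c (h | ⟨h, h'⟩) (k | ⟨k, k'⟩)
    · exact Or.inl (k.trans h)
    · exact Or.inl (k ▸ h)
    · exact Or.inl (h ▸ k)
    · exact Or.inr ⟨h.trans k, _root_.trans h' k'⟩
  have lt_irrefl : ∀ a, ¬ lt a a := by
    rintro a (h | ⟨_, h⟩)
    · exact _root_.lt_irrefl _ h
    · exact irrefl_of r a h
  have lt_total : ∀ a b, a ≠ b → lt a b ∨ lt b a := by
    intro a b hab
    rcases lt_trichotomy (f a) (f b) with h | h | h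
    · exact Or.inr (Or.inl h)
    · rcases trichotomous_of r a b with k | k | k
      · exact Or.inl (Or.inr ⟨h, k⟩)
      · exact absurd k hab
      · exact Or.inr (Or.inr ⟨h.symm, k⟩)
    · exact Or.inl (Or.inl h)
  have fin : ∀ a, {b | lt b a}.Finite := fun a => (hfin (f a) (hf a)).subset (by
    rintro b (h | ⟨h, _⟩)
    · exact h.le
    · exact h.ge)
  let rank : α → ℕ := fun a => {b | lt b a}.ncard
  have mono : ∀ {a b}, lt a b → rank a < rank b := fun {a b} h =>
    Set.ncard_lt_ncard ⟨fun c hc => lt_trans hc h, fun hsub => lt_irrefl a (hsub h)⟩ (fin b)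
  have inj : Function.Injective rank := by
    intro a b h
    by_contra hab
    rcases lt_total a b hab with k | k
    · exact (mono k).ne h
    · exact (mono k).ne' h
  have surj : ∀ n a, n < rank a → ∃ b, rank b = n := by
    intro n a
    induction hm : rank a using Nat.strong_induction_on generalizing a with
    | _ m ih =>
      subst hm
      intro hn
      have hne : {b | lt b a}.Nonempty := (Set.ncard_pos (fin a)).1 (by
        change 0 < rank a; omega)
      -- For `b` the predecessor of `a` of largest rank, every other predecessor of `a` precedes
      -- `b`, so the rank drops by only one and no value is skipped.
      obtain ⟨b, hb, hmax⟩ := Set.exists_max_image _ rank (fin a) hne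
      have hsub : {c | lt c a} ⊆ insert b {c | lt c b} := by
        intro c hc
        by_cases hcb : c = b
        · exact Or.inl hcb
        · rcases lt_total c b hcb with k | k
          · exact Or.inr k
          · exact absurd (hmax c hc) (not_le.2 (mono k))
      have hle : rank a ≤ rank b + 1 :=
        (Set.ncard_le_ncard hsub ((fin b).insert b)).trans (Set.ncard_insert_le _ _)
      by_cases h : n < rank b
      · exact ih _ (mono hb) b rfl h
      · exact ⟨b, by omega⟩
  -- `N` is the least rank not attained, or `⊤` if all are.
  obtain ⟨N, hN⟩ : ∃ N : ℕ∞, ∀ k : ℕ, (k : ℕ∞) < N ↔ ∃ a, rank a = k := by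
    by_cases h : ∀ k : ℕ, ∃ a, rank a = k
    · exact ⟨⊤, fun k => ⟨fun _ => h k, fun _ => ENat.natCast_lt_top k⟩⟩
    · push Not at h
      refine ⟨(Nat.find h : ℕ), fun k => ?_⟩
      rw [Nat.cast_lt]
      refine ⟨fun hk => by simpa using Nat.find_min h hk, ?_⟩
      rintro ⟨a, rfl⟩
      by_contra! hk
      obtain ⟨b, hb⟩ : ∃ b, rank b = Nat.find h := by
        rcases hk.lt_or_eq with k | k
        · exact surj _ a k
        · exact ⟨a, k.symm⟩
      exact Nat.find_spec h b hb
  let e : α ≃ {k : ℕ // (k : ℕ∞) < N} :=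
    Equiv.ofBijective (fun a => ⟨rank a, (hN _).2 ⟨a, rfl⟩⟩)
      ⟨fun a b h => inj (congrArg Subtype.val h), fun k => by
        obtain ⟨a, ha⟩ := (hN k).1 k.2
        exact ⟨a, Subtype.ext ha⟩⟩
  refine ⟨N, e.symm, ?_⟩
  intro j k hjk
  obtain ⟨a, rfl⟩ := e.surjective j
  obtain ⟨b, rfl⟩ := e.surjective k
  simp only [Function.comp_apply, Equiv.symm_apply_apply]
  by_contra! h
  exact absurd (mono (Or.inl h)) (not_lt.2 hjk)

/-! ### Orthonormal expansions and systems of eigenvectors -/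

namespace LeftQuaternionicInnerProductSpace

variable {H : Type*} [NormedAddCommGroup H] [LeftQuaternionicInnerProductSpace H]

theorem qinner_zero_left (u : H) : qinner (0 : H) u = 0 := by
  simpa using qinner_smul_left 0 u u

theorem qinner_eq_zero_symm {u v : H} (h : qinner u v = 0) : qinner v u = 0 := by
  rw [qinner_conj_symm, h, star_zero]

theorem norm_sq_eq_re_qinner (u : H) : ‖u‖ ^ 2 = (qinner u u).re := by
  rw [qinner_self, Quaternion.re_coe]

theorem continuous_qinner_left (v : H) : Continuous fun u : H => qinner u v := by
  let _ := realInnerProductSpace H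
  let f : H →+ ℍ :=
    { toFun := fun u => qinner u v
      map_zero' := qinner_zero_left v
      map_add' := fun a b => qinner_add_left a b v }
  refine AddMonoidHomClass.continuous_of_bound f ‖v‖ fun u => ?_
  change ‖qinner u v‖ ≤ _
  by_cases h : qinner u v = 0
  · rw [h, norm_zero]; positivity
  -- Cauchy–Schwarz: multiplying `u` by the conjugate of `(u, v)` makes the inner product real, so
  -- the real inequality applies.
  have h1 : ‖qinner u v‖ * ‖qinner u v‖ ≤ ‖qinner u v‖ * ‖u‖ * ‖v‖ := by
    calc ‖qinner u v‖ * ‖qinner u v‖ = (qinner (star (qinner u v) • u) v).re := by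
          rw [qinner_smul_left, Quaternion.star_mul_self, Quaternion.re_coe,
            Quaternion.normSq_eq_norm_mul_self]
      _ ≤ ‖star (qinner u v) • u‖ * ‖v‖ := real_inner_le_norm _ v
      _ = _ := by rw [norm_quaternion_smul, norm_star]
  rw [mul_assoc] at h1
  rw [mul_comm ‖v‖]
  exact le_of_mul_le_mul_left h1 (norm_pos_iff.2 h)

/-- The vectors `u` with `(u, v) = 0` for all `v ∈ E`. -/
def qorthogonal (E : Set H) : Submodule ℍ H where
  carrier := {u | ∀ v ∈ E, qinner u v = 0}
  add_mem' ha hb v hv := by rw [qinner_add_left, ha v hv, hb v hv, add_zero]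
  zero_mem' v _ := qinner_zero_left v
  smul_mem' q u hu v hv := by rw [qinner_smul_left, hu v hv, mul_zero]

theorem isClosed_qorthogonal (E : Set H) : IsClosed (qorthogonal E : Set H) := by
  have : (qorthogonal E : Set H) = ⋂ v ∈ E, {u | qinner u v = 0} := by
    ext u; simp [qorthogonal]
  rw [this]
  exact isClosed_biInter fun v _ => isClosed_eq (continuous_qinner_left v) continuous_const

theorem qinner_sub_left (u v w : H) : qinner (u - v) w = qinner u w - qinner v w := by
  rw [eq_sub_iff_add_eq, ← qinner_add_left, sub_add_cancel]

/-- The expansion of `u` along an orthonormal family: the difference of `u` and the sum of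
`(u, ξ i) ξ i` is orthogonal to the family. -/
theorem exists_hasSum_qinner_smul [CompleteSpace H] {ι : Type*} (ξ : ι → H)
    (h1 : ∀ i, ‖ξ i‖ = 1) (h2 : ∀ i j, i ≠ j → qinner (ξ i) (ξ j) = 0) (u : H) :
    ∃ v, HasSum (fun i => qinner u (ξ i) • ξ i) v ∧ ∀ i, qinner (u - v) (ξ i) = 0 := by
  classical
  let _ := realInnerProductSpace H
  -- The lines `ℍ ξ i` are mutually orthogonal isometric copies of `ℍ` over `ℝ`, so the series
  -- converges once the squared norms of its coefficients are summable, which is Bessel's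
  -- inequality.
  let V : ι → (ℍ →ₗᵢ[ℝ] H) := fun i =>
    { toFun := fun q => q • ξ i
      map_add' := fun a b => add_smul a b _
      map_smul' := fun r q => by
        change (r • q) • ξ i = ((r : ℝ) : ℍ) • q • ξ i
        rw [smul_smul, Quaternion.coe_mul_eq_smul]
      norm_map' := fun q => by
        change ‖q • ξ i‖ = _
        rw [norm_quaternion_smul, h1, mul_one] }
  have hV : OrthogonalFamily ℝ (fun _ : ι => ℍ) V := by
    intro i j hij a b
    change (qinner (a • ξ i) (b • ξ j)).re = 0
    rw [qinner_smul_left, qinner_smul_right, h2 i j hij]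
    simp
  have hself : ∀ i, qinner (ξ i) (ξ i) = 1 := fun i => by rw [qinner_self, h1]; simp
  have hbessel : ∀ s : Finset ι, ∑ i ∈ s, ‖qinner u (ξ i)‖ ^ 2 ≤ ‖u‖ ^ 2 := by
    intro s
    have hn := hV.norm_sum (fun i => qinner u (ξ i)) s
    have hin : inner ℝ u (∑ i ∈ s, V i (qinner u (ξ i))) = ∑ i ∈ s, ‖qinner u (ξ i)‖ ^ 2 := by
      rw [inner_sum]
      refine Finset.sum_congr rfl fun i _ => ?_
      change (qinner u (qinner u (ξ i) • ξ i)).re = _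
      rw [qinner_smul_right, Quaternion.self_mul_star, Quaternion.re_coe,
        Quaternion.normSq_eq_norm_mul_self, sq]
    have := norm_sub_sq_real u (∑ i ∈ s, V i (qinner u (ξ i)))
    rw [hin, hn] at this
    nlinarith [sq_nonneg ‖u - ∑ i ∈ s, V i (qinner u (ξ i))‖]
  have hs : Summable fun i => V i (qinner u (ξ i)) :=
    (hV.summable_iff_norm_sq_summable _).2
      (summable_of_sum_le (fun i => sq_nonneg _) hbessel)
  refine ⟨_, hs.hasSum, fun j => ?_⟩
  let f : H →+ ℍ :=
    { toFun := fun w => qinner w (ξ j)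
      map_zero' := qinner_zero_left _
      map_add' := fun a b => qinner_add_left a b _ }
  have hf := hs.hasSum.map f (continuous_qinner_left (ξ j))
  have hf' : HasSum (f ∘ fun i => V i (qinner u (ξ i))) (qinner u (ξ j)) := by
    have hj : qinner u (ξ j) = (f ∘ fun i => V i (qinner u (ξ i))) j := by
      change _ = qinner (qinner u (ξ j) • ξ j) (ξ j)
      rw [qinner_smul_left, hself, mul_one]
    rw [hj]
    refine hasSum_single j fun i hi => ?_
    change qinner (qinner u (ξ i) • ξ i) (ξ j) = 0
    rw [qinner_smul_left, h2 i j hi, mul_zero]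
  rw [qinner_sub_left, sub_eq_zero]
  exact hf'.unique hf

theorem qinner_qadjoint_left [CompleteSpace H] (T : H →L[ℍ] H) (u v : H) :
    qinner (qadjoint T u) v = qinner u (T v) := by
  rw [qinner_conj_symm, ← qinner_qadjoint, ← qinner_conj_symm]

theorem IsNormalOperator.norm_qadjoint_apply [CompleteSpace H] {T : H →L[ℍ] H}
    (hn : IsNormalOperator T) (u : H) : ‖qadjoint T u‖ = ‖T u‖ := by
  rw [← sq_eq_sq₀ (norm_nonneg _) (norm_nonneg _), norm_sq_eq_re_qinner, norm_sq_eq_re_qinner,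
    qinner_qadjoint_left, qinner_qadjoint]
  exact congrArg (fun F : H →L[ℍ] H => (qinner u (F u)).re) hn

/-- An eigenvector of a normal operator is an eigenvector of the adjoint. -/
theorem IsNormalOperator.qadjoint_apply_of_apply_eq_smul [CompleteSpace H] {T : H →L[ℍ] H}
    (hn : IsNormalOperator T) {u : H} {q : ℍ} (h : T u = q • u) :
    qadjoint T u = star q • u := by
  let _ := realInnerProductSpace H
  -- In the expansion of `‖T* u - q̄ u‖²` both squares and the inner product equal `‖q‖² ‖u‖²`, so
  -- the total is `0`.
  have h1 := norm_sub_sq_real (qadjoint T u) (star q • u)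
  have h2 : inner ℝ (qadjoint T u) (star q • u) = ‖q‖ ^ 2 * ‖u‖ ^ 2 := by
    change (qinner (qadjoint T u) (star q • u)).re = _
    rw [qinner_qadjoint_left, T.map_smul, h, qinner_smul_right, qinner_smul_right, qinner_self,
      star_star, mul_assoc, Quaternion.star_mul_self, Quaternion.normSq_eq_norm_mul_self,
      ← Quaternion.coe_mul, Quaternion.re_coe]
    ring
  rw [h2, hn.norm_qadjoint_apply, h, norm_quaternion_smul, norm_quaternion_smul, norm_star] at h1
  have h3 : ‖qadjoint T u - star q • u‖ ^ 2 = 0 := by rw [h1]; ring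
  exact sub_eq_zero.1 (norm_eq_zero.1 (pow_eq_zero_iff two_ne_zero |>.1 h3))

/-- `E` is an orthonormal set of eigenvectors of `T` with nonzero eigenvalues. -/
structure IsEigenvectorSystem (T : H →L[ℍ] H) (E : Set H) : Prop where
  norm_eq_one : ∀ x ∈ E, ‖x‖ = 1
  qinner_eq_zero : ∀ x ∈ E, ∀ y ∈ E, x ≠ y → qinner x y = 0
  exists_eigenvalue : ∀ x ∈ E, ∃ q : ℍ, q ≠ 0 ∧ T x = q • x

theorem exists_maximal_isEigenvectorSystem (T : H →L[ℍ] H) :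
    ∃ E, Maximal (IsEigenvectorSystem T) E := by
  refine zorn_subset {E | IsEigenvectorSystem T E} fun c hc hchain =>
    ⟨⋃₀ c, ⟨?_, ?_, ?_⟩, fun s hs => Set.subset_sUnion_of_mem hs⟩
  · rintro x ⟨s, hs, hx⟩
    exact (hc hs).norm_eq_one x hx
  · rintro x ⟨s, hs, hx⟩ y ⟨t, ht, hy⟩ hxy
    rcases hchain.total hs ht with h | h
    · exact (hc ht).qinner_eq_zero x (h hx) y hy hxy
    · exact (hc hs).qinner_eq_zero x hx y (h hy) hxy
  · rintro x ⟨s, hs, hx⟩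
    exact (hc hs).exists_eigenvalue x hx

/-- A compact normal operator vanishes on the orthogonal complement of a maximal orthonormal
system of eigenvectors with nonzero eigenvalues. -/
theorem apply_eq_zero_of_mem_qorthogonal [CompleteSpace H] {T : H →L[ℍ] H}
    (hc : IsCompactOp T) (hn : IsNormalOperator T) {E : Set H}
    (hE : Maximal (IsEigenvectorSystem T) E) {w : H} (hw : w ∈ qorthogonal E) : T w = 0 := by
  by_contra hTw
  obtain ⟨q, hq, u, hu, hu0, hTu⟩ := exists_eigenvector_mem hc hn (qorthogonal E)
    (isClosed_qorthogonal E)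
    (fun w hw v hv => by
      obtain ⟨q, -, hq⟩ := hE.prop.exists_eigenvalue v hv
      rw [qinner_qadjoint, hn.qadjoint_apply_of_apply_eq_smul hq, qinner_smul_right, hw v hv,
        zero_mul])
    (fun w hw v hv => by
      obtain ⟨q, -, hq⟩ := hE.prop.exists_eigenvalue v hv
      rw [qinner_qadjoint_left, hq, qinner_smul_right, hw v hv, zero_mul]) hw hTw
  -- Scaling an eigenvector by a quaternion conjugates its eigenvalue; a real factor is central and
  -- keeps `q`.
  have hr : ((‖u‖⁻¹ : ℝ) : ℍ) * q = q * ((‖u‖⁻¹ : ℝ) : ℍ) := Quaternion.coe_commutes _ _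
  have hu' : ‖u‖ ≠ 0 := norm_ne_zero_iff.2 hu0
  let x : H := ((‖u‖⁻¹ : ℝ) : ℍ) • u
  have hx : x ∈ qorthogonal E := (qorthogonal E).smul_mem _ hu
  have hx1 : ‖x‖ = 1 := by
    rw [norm_quaternion_smul, Quaternion.norm_coe, norm_inv, norm_norm, inv_mul_cancel₀ hu']
  have hTx : T x = q • x := by rw [T.map_smul, hTu, smul_smul, smul_smul, hr]
  have hins : IsEigenvectorSystem T (insert x E) := by
    refine ⟨?_, ?_, ?_⟩
    · rintro y (rfl | hy)
      · exact hx1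
      · exact hE.prop.norm_eq_one y hy
    · rintro y (rfl | hy) z (rfl | hz) hyz
      · exact absurd rfl hyz
      · exact hx z hz
      · exact qinner_eq_zero_symm (hx y hy)
      · exact hE.prop.qinner_eq_zero y hy z hz hyz
    · rintro y (rfl | hy)
      · exact ⟨q, hq, hTx⟩
      · exact hE.prop.exists_eigenvalue y hy
  have hxE : x ∈ E := hE.le_of_ge hins (Set.subset_insert x E) (Set.mem_insert x E)
  have h0 := hx x hxE
  rw [qinner_self, hx1] at h0
  simp at h0

/-- A compact operator has only finitely many orthonormal eigenvectors whose eigenvalues are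
bounded away from `0`. -/
theorem IsEigenvectorSystem.finite_setOf_le_norm_apply {T : H →L[ℍ] H} (hc : IsCompactOp T)
    {E : Set H} (hE : IsEigenvectorSystem T E) {ε : ℝ} (hε : 0 < ε) :
    {x : E | ε ≤ ‖T x‖}.Finite := by
  let _ := realInnerProductSpace H
  have htb := (hc (Metric.closedBall 0 1) Metric.isBounded_closedBall).totallyBounded
  -- Images of distinct members of `E` are orthogonal, so those of norm at least `ε` are at least
  -- `ε` apart. Two points within `ε / 2` of the same centre are closer than that, so the choice of
  -- a centre is injective.
  obtain ⟨t, ht, hcov⟩ := Metric.totallyBounded_iff.1 htb (ε / 2) (half_pos hε)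
  have hmem : ∀ x : E, ∃ y ∈ t, dist (T x) y < ε / 2 := by
    intro x
    have : T x ∈ ⋃ y ∈ t, Metric.ball y (ε / 2) :=
      hcov (subset_closure (Set.mem_image_of_mem _ (by simp [hE.norm_eq_one x x.2])))
    simpa using this
  choose g hg hdist using hmem
  refine Set.Finite.of_finite_image (f := g) (ht.subset (by rintro _ ⟨x, -, rfl⟩; exact hg x)) ?_
  intro x hx y hy hxy
  by_contra hne
  have horth : inner ℝ (T x) (T y) = 0 := by
    obtain ⟨p, -, hp⟩ := hE.exists_eigenvalue x x.2
    obtain ⟨q, -, hq⟩ := hE.exists_eigenvalue y y.2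
    change (qinner (T x) (T y)).re = 0
    rw [hp, hq, qinner_smul_left, qinner_smul_right,
      hE.qinner_eq_zero x x.2 y y.2 (fun h => hne (Subtype.ext h))]
    simp
  have h1 := norm_sub_sq_real (T x) (T y)
  rw [horth] at h1
  have h2 : ‖T x - T y‖ < ε := by
    rw [← dist_eq_norm]
    have := dist_triangle_right (T x) (T y) (g x)
    have h3 := hdist y
    rw [← hxy] at h3
    linarith [hdist x]
  have hx' : ε ≤ ‖T x‖ := hx
  nlinarith [norm_nonneg (T x - T y), sq_nonneg ‖T y‖]

end LeftQuaternionicInnerProductSpace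

/-! ### The spectral theorem -/

open LeftQuaternionicInnerProductSpace in
theorem mainTheorem2 {H : Type*} [NormedAddCommGroup H] [LeftQuaternionicInnerProductSpace H]
    [CompleteSpace H] (T : H →L[ℍ] H)
    (hcompact : LeftQuaternionicInnerProductSpace.IsCompactOp T)
    (hnormal : LeftQuaternionicInnerProductSpace.IsNormalOperator T) :
    -- the sequences are indexed by the natural numbers `k < N`, where `N` may be infinite
    ∃ (N : ℕ∞) (lam : {k : ℕ // (k : ℕ∞) < N} → ℍ) (ξ : {k : ℕ // (k : ℕ∞) < N} → H),
      (∀ j k, j ≤ k → ‖lam k‖ ≤ ‖lam j‖) ∧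
      (∀ k, ‖ξ k‖ = 1) ∧
      (∀ k, LeftQuaternionicInnerProductSpace.IsEigenvalue T (lam k)) ∧
      (N = ⊤ → Tendsto (fun k => ‖lam k‖) atTop (𝓝 0)) ∧
      (∀ k, T (ξ k) = lam k • ξ k) ∧
      (∀ k, (T ∘L LeftQuaternionicInnerProductSpace.qadjoint T) (ξ k) =
        ((‖lam k‖ ^ 2 : ℝ) : ℍ) • ξ k) ∧
      (∀ u : H, HasSum
        (fun k => (LeftQuaternionicInnerProductSpace.qinner u (ξ k) * lam k) • ξ k) (T u)) ∧
      (∀ u : H, HasSum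
        (fun k => (LeftQuaternionicInnerProductSpace.qinner u (ξ k) *
          ((‖lam k‖ ^ 2 : ℝ) : ℍ)) • ξ k)
        ((T ∘L LeftQuaternionicInnerProductSpace.qadjoint T) u)) ∧
      (¬ LeftQuaternionicInnerProductSpace.IsEigenvalue T 0 →
        LeftQuaternionicInnerProductSpace.IsOrthonormalBasis ξ) := by
  obtain ⟨E, hE⟩ := exists_maximal_isEigenvectorSystem T
  choose q hq0 hq using fun x : E => hE.prop.exists_eigenvalue x x.2
  have hnorm : ∀ x : E, ‖T x‖ = ‖q x‖ := fun x => by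
    rw [hq, norm_quaternion_smul, hE.prop.norm_eq_one x x.2, mul_one]
  have hfin : ∀ ε > 0, {x : E | ε ≤ ‖q x‖}.Finite := fun ε hε => by
    simpa only [hnorm] using hE.prop.finite_setOf_le_norm_apply hcompact hε
  obtain ⟨N, e, he⟩ := exists_enumeration_antitone (fun x : E => ‖q x‖)
    (fun x => norm_pos_iff.2 (hq0 x)) hfin
  have hξ1 : ∀ k, ‖(e k : H)‖ = 1 := fun k => hE.prop.norm_eq_one _ (e k).2
  have hξ2 : ∀ j k, j ≠ k → qinner (e j : H) (e k) = 0 := fun j k hjk =>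
    hE.prop.qinner_eq_zero _ (e j).2 _ (e k).2 fun h => hjk (e.injective (Subtype.ext h))
  have hK : ∀ k, (T ∘L qadjoint T) (e k : H) = ((‖q (e k)‖ ^ 2 : ℝ) : ℍ) • (e k : H) := fun k => by
    rw [ContinuousLinearMap.comp_apply, hnormal.qadjoint_apply_of_apply_eq_smul (hq (e k)),
      T.map_smul, hq, smul_smul, Quaternion.star_mul_self, Quaternion.normSq_eq_norm_mul_self, sq]
  have hexp : ∀ u : H, ∃ v, HasSum (fun k => qinner u (e k : H) • (e k : H)) v ∧ T (u - v) = 0 := by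
    intro u
    obtain ⟨v, hv, hv'⟩ := exists_hasSum_qinner_smul (fun k => (e k : H)) hξ1 hξ2 u
    refine ⟨v, hv, apply_eq_zero_of_mem_qorthogonal hcompact hnormal hE fun x hx => ?_⟩
    simpa using hv' (e.symm ⟨x, hx⟩)
  -- Treats `T` and `T T*` at once: an operator killing the kernel of `T` does not see `u - v`, and
  -- acts termwise on the expansion `v`.
  have hsum : ∀ (S : H →L[ℍ] H) (c : {k : ℕ // (k : ℕ∞) < N} → ℍ),
      (∀ w, T w = 0 → S w = 0) → (∀ k, S (e k) = c k • (e k : H)) → ∀ u : H,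
      HasSum (fun k => (qinner u (e k : H) * c k) • (e k : H)) (S u) := by
    intro S c hS hSe u
    obtain ⟨v, hv, hv'⟩ := hexp u
    have h1 : S u = S v := by simpa [sub_eq_zero] using hS _ hv'
    rw [h1]
    simpa [Function.comp_def, hSe, smul_smul] using hv.map S S.continuous
  refine ⟨N, fun k => q (e k), fun k => e k, fun j k hjk => he hjk, hξ1,
    fun k => ⟨e k, norm_ne_zero_iff.1 (by simp [hξ1]), hq (e k)⟩, ?_, fun k => hq (e k), hK,
    hsum T _ (fun _ h => h) fun k => hq (e k), hsum _ _ (fun w hw => ?_) hK, fun h0 => ?_⟩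
  · rintro rfl
    have hcast : ∀ k : ℕ, (k : ℕ∞) < ⊤ := ENat.natCast_lt_top
    have : Nonempty {k : ℕ // (k : ℕ∞) < ⊤} := ⟨⟨0, hcast 0⟩⟩
    refine Metric.tendsto_atTop.2 fun ε hε => ?_
    -- One small term suffices, since the moduli decrease; without one, infinitely many would be at
    -- least `ε`.
    obtain ⟨k, hk⟩ : ∃ k, ‖q (e k)‖ < ε := by
      by_contra! h
      have hinf : Infinite {k : ℕ // (k : ℕ∞) < ⊤} :=
        Infinite.of_injective (fun k : ℕ => (⟨k, hcast k⟩ : {k : ℕ // (k : ℕ∞) < ⊤}))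
          fun _ _ h => congrArg Subtype.val h
      have : (e ⁻¹' {x : E | ε ≤ ‖q x‖}).Finite := (hfin ε hε).preimage e.injective.injOn
      exact Set.infinite_univ (this.subset fun k _ => h k)
    refine ⟨k, fun j hj => ?_⟩
    rw [Real.dist_0_eq_abs, abs_of_nonneg (norm_nonneg _)]
    exact (he hj).trans_lt hk
  · have h : qadjoint T w = 0 := by
      rw [← norm_eq_zero, hnormal.norm_qadjoint_apply, hw, norm_zero]
    rw [ContinuousLinearMap.comp_apply, h, map_zero]
  · refine ⟨hξ1, hξ2, Set.eq_univ_of_forall fun u => ?_⟩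
    obtain ⟨v, hv, hv'⟩ := hexp u
    have huv : u = v := by
      by_contra hne
      exact h0 ⟨u - v, sub_ne_zero.2 hne, by rw [hv', zero_smul]⟩
    rw [huv]
    exact mem_closure_of_tendsto hv (Eventually.of_forall fun s =>
      Submodule.sum_mem _ fun k _ => Submodule.smul_mem _ _ (Submodule.subset_span ⟨k, rfl⟩))
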